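/- Let $q$ be a prime power and $\mathbb F_q$ the field with $q$ elements. For $n\ge 1$ equip $\mathrm{SL}_n(q)$ with the normalized rank metric $d(g,h)=\frac1n\operatorname{rank}(g-h)$, which is bi-invariant. The diagonal embeddings $\mathrm{SL}_{2^n}(q)\to \mathrm{SL}_{2^{n+1}}(q)$, $g\mapsto\begin{pmatrix} g&0\\0&g\end{pmatrix}$, are isometric homomorphisms; let $A_0(q)$ be their inductive limit with the induced metric, and let $A(q)$ be the metric completion of $A_0(q)$, a Polish group whose metric $d$ is complete and bi-invariant. For a metric space $(X,d)$ with a Borel probability measure $\mu$, let $$\alpha_{(X,d,\mu)}(r)=\sup\{\,1-\mu(N_r(A)) : A\subseteq X \text{ Borel},\ \mu(A)\ge \tfrac12\,\},\qquad r>0,$$ where $N_r(A)=\{x\in X: \exists\, y\in A,\ d(x,y)<r\}$. A sequence $(X_n,d_n,\mu_n)$ of such spaces, all of diameter $1$, is a Lévy family if $\alpha_{(X_n,d_n,\mu_n)}(r)\to0$ for every $r>0$. A Polish group $G$ with a compatible left-invariant metric $d$ is a Lévy group if there is an increasing sequence $(G_n)_n$ of compact subgroups of $G$ with dense union such that $(G_n,d|_{G_n},\mu_n)_n$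 is a Lévy family, where $\mu_n$ is the normalized Haar measure of $G_n$. A topological group is extremely amenable if each of its continuous actions on a nonempty compact Hausdorff space has a fixed point. Theorem. (1) The groups $\mathrm{SL}_{2^n}(q)$, $n\ge1$, with the normalized rank metric and the normalized counting measure form a Lévy family. (2) $A(q)$, with its metric $d$, is a Lévy group. (3) $A(q)$ is extremely amenable. -/

import Mathlib

open Set Filter Topology MeasureTheory

universe u v

noncomputable section

/-! ### Concentration of measure -/

/-- The concentration function `r ↦ sup {1 - μ (N_r A) | A ⊆ X measurable, μ A ≥ 1 / 2}` of a
metric space with a probability measure; `Metric.thickening r A` is the open `r`-neighbourhood. -/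
def concentrationFunction {X : Type*} [MetricSpace X] [MeasurableSpace X] (μ : Measure X)
    (r : ℝ) : ℝ :=
  sSup {t : ℝ | ∃ A : Set X, MeasurableSet A ∧ 1 / 2 ≤ μ.real A ∧
    t = 1 - μ.real (Metric.thickening r A)}

/-- A sequence of metric probability spaces of diameter `1` is a Lévy family if its concentration
functions tend to `0` at every `r > 0`. -/
structure IsLevyFamily (X : ℕ → Type*) [∀ n, MetricSpace (X n)] [∀ n, MeasurableSpace (X n)]
    [∀ n, BorelSpace (X n)] (μ : ∀ n, Measure (X n)) : Prop where
  isProbabilityMeasure : ∀ n, IsProbabilityMeasure (μ n)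
  diam_eq_one : ∀ n, Metric.diam (univ : Set (X n)) = 1
  tendsto_zero : ∀ r : ℝ, 0 < r → Tendsto (fun n => concentrationFunction (μ n) r) atTop (𝓝 0)

/-- A Polish group with a compatible left-invariant metric is a Lévy group if it has an increasing
sequence of compact subgroups with dense union which, with their normalized Haar measures and the
restricted metrics, form a Lévy family. -/
def IsLevyGroup (G : Type*) [Group G] [MetricSpace G] [IsTopologicalGroup G] [PolishSpace G]
    [IsIsometricSMul G G] [MeasurableSpace G] [BorelSpace G] : Prop :=
  ∃ (H : ℕ → Subgroup G) (μ : ∀ n, Measure (H n)),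
    Monotone H ∧ Dense (⋃ n, (H n : Set G)) ∧ (∀ n, IsCompact (H n : Set G)) ∧
    (∀ n, (μ n).IsHaarMeasure) ∧ (∀ n, IsProbabilityMeasure (μ n)) ∧
    IsLevyFamily (fun n => H n) μ

/-- A topological group is extremely amenable if each of its (jointly) continuous actions on a
nonempty compact Hausdorff space has a fixed point. -/
def IsExtremelyAmenable (G : Type u) [Group G] [TopologicalSpace G] : Prop :=
  ∀ (X : Type v) [TopologicalSpace X] [CompactSpace X] [T2Space X] [Nonempty X]
    [MulAction G X] [ContinuousSMul G X], ∃ x : X, ∀ g : G, g • x = x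

/-! ### Special linear groups with the normalized rank metric -/

/-- The group `SL_n(F)`, to be equipped with the normalized rank metric. -/
def RankSL (F : Type u) [Field F] (n : ℕ) : Type u := Matrix.SpecialLinearGroup (Fin n) F

namespace RankSL

variable {F : Type u} [Field F] {n : ℕ}

instance : Group (RankSL F n) := inferInstanceAs (Group (Matrix.SpecialLinearGroup (Fin n) F))

instance [Finite F] : Finite (RankSL F n) :=
  inferInstanceAs (Finite (Matrix.SpecialLinearGroup (Fin n) F))

/-- The underlying matrix. -/
def toMatrix (g : RankSL F n) : Matrix (Fin n) (Fin n) F := g.1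

theorem toMatrix_injective : Function.Injective (toMatrix : RankSL F n → _) :=
  fun _ _ h => Subtype.ext h

theorem det_toMatrix (g : RankSL F n) : g.toMatrix.det = 1 := g.2

theorem toMatrix_mul (g h : RankSL F n) : (g * h).toMatrix = g.toMatrix * h.toMatrix := rfl

theorem toMatrix_one : (1 : RankSL F n).toMatrix = 1 := rfl

theorem rank_add_le {m : Type*} [Fintype m] (A B : Matrix m m F) :
    (A + B).rank ≤ A.rank + B.rank := by
  classical
  unfold Matrix.rank
  rw [Matrix.mulVecLin_add]
  refine le_trans (Submodule.finrank_mono ?_)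
    (Submodule.finrank_add_le_finrank_add_finrank (LinearMap.range A.mulVecLin)
      (LinearMap.range B.mulVecLin))
  rintro _ ⟨x, rfl⟩
  exact Submodule.add_mem_sup ⟨x, rfl⟩ ⟨x, rfl⟩

theorem rank_neg {m : Type*} [Fintype m] (A : Matrix m m F) : (-A).rank = A.rank := by
  classical
  have h : -A = A * (-1) := by simp
  rw [h]
  refine Matrix.rank_mul_eq_left_of_isUnit_det _ _ ?_
  rw [Matrix.det_neg, Matrix.det_one, mul_one]
  exact (isUnit_one.neg).pow _

theorem eq_zero_of_rank_eq_zero {m : Type*} [Fintype m] (A : Matrix m m F)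
    (h : A.rank = 0) : A = 0 := by
  classical
  unfold Matrix.rank at h
  rw [Submodule.finrank_eq_zero, LinearMap.range_eq_bot] at h
  ext i j
  have := congrFun (LinearMap.congr_fun h (Pi.single j 1)) i
  simpa using this

/-- The normalized rank metric `d(g, h) = rank (g - h) / n`. -/
instance : MetricSpace (RankSL F n) where
  dist g h := ((g.toMatrix - h.toMatrix).rank : ℝ) / n
  dist_self g := by simp
  dist_comm g h := by
    rw [← rank_neg, neg_sub]
  dist_triangle g h k := by
    rw [← add_div]
    gcongr
    have := rank_add_le (g.toMatrix - h.toMatrix) (h.toMatrix - k.toMatrix)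
    rw [sub_add_sub_cancel] at this
    exact_mod_cast this
  eq_of_dist_eq_zero := by
    intro g h hgh
    change (_ : ℝ) / n = 0 at hgh
    rcases Nat.eq_zero_or_pos n with rfl | hn
    · exact toMatrix_injective (Subsingleton.elim _ _)
    · have hn' : (n : ℝ) ≠ 0 := by positivity
      rw [div_eq_zero_iff, or_iff_left hn'] at hgh
      exact toMatrix_injective (sub_eq_zero.1 (eq_zero_of_rank_eq_zero _ (by exact_mod_cast hgh)))

theorem dist_def (g h : RankSL F n) :
    dist g h = ((g.toMatrix - h.toMatrix).rank : ℝ) / n := rfl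

/-- The Borel σ-algebra of the rank metric. -/
instance : MeasurableSpace (RankSL F n) := borel _

instance : BorelSpace (RankSL F n) := ⟨rfl⟩

instance : IsIsometricSMul (RankSL F n) (RankSL F n) :=
  ⟨fun g => Isometry.of_dist_eq fun x y => by
    simp only [smul_eq_mul, dist_def, toMatrix_mul, ← mul_sub]
    rw [Matrix.rank_mul_eq_right_of_isUnit_det _ _ (by simp [det_toMatrix])]⟩

instance : IsIsometricSMul (RankSL F n)ᵐᵒᵖ (RankSL F n) :=
  ⟨fun g => Isometry.of_dist_eq fun x y => by
    simp only [MulOpposite.smul_eq_mul_unop, dist_def, toMatrix_mul, ← sub_mul]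
    rw [Matrix.rank_mul_eq_left_of_isUnit_det _ _ (by simp [det_toMatrix])]⟩

/-- The bijection between two consecutive blocks of length `2 ^ n` and `{0, …, 2 ^ (n + 1) - 1}`. -/
def blockEquiv (n : ℕ) : Fin (2 ^ n) ⊕ Fin (2 ^ n) ≃ Fin (2 ^ (n + 1)) :=
  finSumFinEquiv.trans (finCongr (by rw [pow_succ, mul_two]))

variable (F) in
/-- The diagonal embedding `g ↦ diag(g, g)` of `SL_{2^n}(F)` into `SL_{2^(n+1)}(F)`. -/
def doubling (n : ℕ) : RankSL F (2 ^ n) →* RankSL F (2 ^ (n + 1)) where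
  toFun g := ⟨Matrix.reindex (blockEquiv n) (blockEquiv n)
    (Matrix.fromBlocks g.toMatrix 0 0 g.toMatrix), by
      rw [Matrix.det_reindex_self, Matrix.det_fromBlocks_zero₂₁, det_toMatrix, one_mul]⟩
  map_one' := by
    apply toMatrix_injective
    change Matrix.reindex _ _ _ = 1
    simp [toMatrix_one, Matrix.fromBlocks_one]
  map_mul' g h := by
    apply toMatrix_injective
    change Matrix.reindex _ _ _ = Matrix.reindex _ _ _ * Matrix.reindex _ _ _
    simp [toMatrix_mul, Matrix.fromBlocks_multiply, Matrix.submatrix_mul_equiv]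

theorem toMatrix_doubling (n : ℕ) (g : RankSL F (2 ^ n)) :
    (doubling F n g).toMatrix = Matrix.reindex (blockEquiv n) (blockEquiv n)
      (Matrix.fromBlocks g.toMatrix 0 0 g.toMatrix) := rfl

theorem rank_fromBlocks_diagonal {m : Type*} [Fintype m] (A : Matrix m m F) :
    (Matrix.fromBlocks A 0 0 A).rank = A.rank + A.rank := by
  classical
  let e := LinearEquiv.sumArrowLequivProdArrow m m F F
  have h : (Matrix.fromBlocks A 0 0 A).mulVecLin =
      e.symm.toLinearMap ∘ₗ (A.mulVecLin.prodMap A.mulVecLin) ∘ₗ e.toLinearMap := by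
    apply LinearMap.ext
    intro x
    funext i
    rcases i with i | i <;>
      simp [e, Matrix.fromBlocks_mulVec, Function.comp_def] <;> rfl
  unfold Matrix.rank
  rw [h, LinearMap.range_comp, LinearMap.range_comp_of_range_eq_top _ e.range,
    LinearMap.range_prodMap]
  erw [LinearEquiv.finrank_map_eq]
  rw [← Module.finrank_prod]
  let S := LinearMap.range A.mulVecLin
  let p : (S.prod S) ≃ₗ[F] S × S :=
    { toFun := fun x => (⟨x.1.1, x.2.1⟩, ⟨x.1.2, x.2.2⟩)
      invFun := fun x => ⟨(x.1.1, x.2.1), x.1.2, x.2.2⟩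
      map_add' := fun _ _ => rfl
      map_smul' := fun _ _ => rfl
      left_inv := fun _ => rfl
      right_inv := fun _ => rfl }
  exact p.finrank_eq

theorem isometry_doubling (n : ℕ) : Isometry (doubling F n) :=
  Isometry.of_dist_eq fun g h => by
    rw [dist_def, dist_def, toMatrix_doubling, toMatrix_doubling]
    have e : Matrix.reindex (blockEquiv n) (blockEquiv n)
          (Matrix.fromBlocks g.toMatrix 0 0 g.toMatrix) -
        Matrix.reindex (blockEquiv n) (blockEquiv n)
          (Matrix.fromBlocks h.toMatrix 0 0 h.toMatrix) =
        Matrix.reindex (blockEquiv n) (blockEquiv n)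
          (Matrix.fromBlocks (g.toMatrix - h.toMatrix) 0 0 (g.toMatrix - h.toMatrix)) := by
      rw [sub_eq_add_neg, sub_eq_add_neg, ← add_zero (0 : Matrix (Fin (2 ^ n)) (Fin (2 ^ n)) F),
        ← Matrix.fromBlocks_add]
      ext i j
      rcases hi : (blockEquiv n).symm i with a | a <;>
        rcases hj : (blockEquiv n).symm j with b | b <;> simp [hi, hj]
    rw [e, Matrix.rank_reindex, rank_fromBlocks_diagonal]
    push_cast
    rw [pow_succ]
    field_simp
    ring

variable (F) in
/-- The transition map `SL_{2^m}(F) → SL_{2^n}(F)` for `m ≤ n`, the composite of the diagonal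
embeddings at the levels `m, m + 1, …, n - 1`. -/
def transition (m n : ℕ) (h : m ≤ n) : RankSL F (2 ^ m) →* RankSL F (2 ^ n) :=
  Nat.leRecOn (C := fun k => RankSL F (2 ^ m) →* RankSL F (2 ^ k)) h
    (fun {k} f => (doubling F k).comp f) (MonoidHom.id _)

theorem transition_self (m : ℕ) : transition F m m le_rfl = MonoidHom.id _ :=
  Nat.leRecOn_self _

theorem transition_succ (m n : ℕ) (h : m ≤ n) :
    transition F m (n + 1) (h.trans n.le_succ) = (doubling F n).comp (transition F m n h) :=
  Nat.leRecOn_succ h _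

theorem isometry_transition (m n : ℕ) (h : m ≤ n) : Isometry (transition F m n h) := by
  induction n, h using Nat.le_induction with
  | base => rw [transition_self]; exact isometry_id
  | succ n h ih =>
    rw [transition_succ m n h]
    exact (isometry_doubling n).comp ih

instance : DirectedSystem (fun n => RankSL F (2 ^ n)) (fun m n h => transition F m n h) where
  map_self m x := by rw [transition_self]; rfl
  map_map k j i hij hjk x := by
    induction k, hjk using Nat.le_induction with
    | base => rw [transition_self]; rfl
    | succ n h ih =>
      rw [transition_succ _ n h, transition_succ i n (hij.trans h), MonoidHom.comp_apply, ih,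
        MonoidHom.comp_apply]

end RankSL

/-! ### The inductive limit and its completion -/

/-- The inductive limit `A₀(F)` of the groups `SL_{2^n}(F)` along the diagonal embeddings. -/
def RankLimit (F : Type u) [Field F] : Type u :=
  DirectLimit (fun n => RankSL F (2 ^ n)) (RankSL.transition F)

namespace RankLimit

variable {F : Type u} [Field F]

instance : Group (RankLimit F) :=
  inferInstanceAs (Group (DirectLimit (fun n => RankSL F (2 ^ n)) (RankSL.transition F)))

instance [Finite F] : Countable (RankLimit F) :=
  inferInstanceAs (Countable (Quotient _))

variable (F) in
/-- The canonical homomorphism `SL_{2^n}(F) → A₀(F)`. -/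
def of (n : ℕ) : RankSL F (2 ^ n) →* RankLimit F where
  toFun g := (⟦⟨n, g⟩⟧ : DirectLimit (fun n => RankSL F (2 ^ n)) (RankSL.transition F))
  map_one' := (DirectLimit.one_def n).symm
  map_mul' g h := (DirectLimit.mul_def (G := fun n => RankSL F (2 ^ n))
    (f := RankSL.transition F) n g h).symm

theorem exists_of₂ (x y : RankLimit F) : ∃ n g h, x = of F n g ∧ y = of F n h :=
  DirectLimit.exists_eq_mk₂ (F := fun n => RankSL F (2 ^ n)) (RankSL.transition F) x y

theorem exists_of₃ (x y z : RankLimit F) :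
    ∃ n g h k, x = of F n g ∧ y = of F n h ∧ z = of F n k :=
  DirectLimit.exists_eq_mk₃ (F := fun n => RankSL F (2 ^ n)) (RankSL.transition F) x y z

/-- The common extension of the normalized rank metrics on the groups `SL_{2^n}(F)`. -/
instance : Dist (RankLimit F) where
  dist := DirectLimit.lift₂ (RankSL.transition F) (RankSL.transition F) (fun _ g h => dist g h)
    (fun m n h x y => ((RankSL.isometry_transition m n h).dist_eq x y).symm)

theorem dist_of (n : ℕ) (g h : RankSL F (2 ^ n)) : dist (of F n g) (of F n h) = dist g h :=
  DirectLimit.lift₂_def (F₁ := fun n => RankSL F (2 ^ n)) (F₂ := fun n => RankSL F (2 ^ n))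
    (RankSL.transition F) (RankSL.transition F) (fun _ g h => dist g h)
    (fun m n h x y => ((RankSL.isometry_transition m n h).dist_eq x y).symm) n g h

instance : MetricSpace (RankLimit F) where
  dist_self x := by
    obtain ⟨n, g, -, rfl, -⟩ := exists_of₂ x x
    rw [dist_of, dist_self]
  dist_comm x y := by
    obtain ⟨n, g, h, rfl, rfl⟩ := exists_of₂ x y
    rw [dist_of, dist_of, dist_comm]
  dist_triangle x y z := by
    obtain ⟨n, g, h, k, rfl, rfl, rfl⟩ := exists_of₃ x y z
    rw [dist_of, dist_of, dist_of]
    exact dist_triangle _ _ _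
  eq_of_dist_eq_zero := by
    intro x y hxy
    obtain ⟨n, g, h, rfl, rfl⟩ := exists_of₂ x y
    rw [dist_of] at hxy
    rw [eq_of_dist_eq_zero hxy]

instance : IsIsometricSMul (RankLimit F) (RankLimit F) :=
  ⟨fun z => Isometry.of_dist_eq fun x y => by
    obtain ⟨n, k, g, h, rfl, rfl, rfl⟩ := exists_of₃ z x y
    simp only [smul_eq_mul, ← map_mul, dist_of, dist_mul_left]⟩

instance : IsIsometricSMul (RankLimit F)ᵐᵒᵖ (RankLimit F) :=
  ⟨fun z => Isometry.of_dist_eq fun x y => by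
    obtain ⟨n, k, g, h, hz, rfl, rfl⟩ := exists_of₃ z.unop x y
    simp only [MulOpposite.smul_eq_mul_unop, hz, ← map_mul, dist_of, dist_mul_right]⟩

theorem uniformContinuous_mul : UniformContinuous₂ (fun x y : RankLimit F => x * y) := by
  refine LipschitzWith.uniformContinuous (K := 2) (LipschitzWith.of_dist_le_mul ?_)
  rintro ⟨a, b⟩ ⟨c, d⟩
  change dist (a * b) (c * d) ≤ _
  calc dist (a * b) (c * d) ≤ dist (a * b) (c * b) + dist (c * b) (c * d) := dist_triangle _ _ _
    _ = dist a c + dist b d := by rw [dist_mul_right, dist_mul_left]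
    _ ≤ dist (a, b) (c, d) + dist (a, b) (c, d) := by
      rw [Prod.dist_eq]; exact add_le_add (le_max_left _ _) (le_max_right _ _)
    _ = ((2 : NNReal) : ℝ) * dist (a, b) (c, d) := by push_cast; ring

theorem uniformContinuous_inv : UniformContinuous (fun x : RankLimit F => x⁻¹) :=
  (isometry_inv (G := RankLimit F)).uniformContinuous

end RankLimit

/-- The group `A(F)`: the metric completion of `A₀(F)`. -/
def RankCompletion (F : Type u) [Field F] : Type u := UniformSpace.Completion (RankLimit F)

namespace RankCompletion

open UniformSpace

variable {F : Type u} [Field F]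

instance : MetricSpace (RankCompletion F) :=
  inferInstanceAs (MetricSpace (Completion (RankLimit F)))

instance : CompleteSpace (RankCompletion F) :=
  inferInstanceAs (CompleteSpace (Completion (RankLimit F)))

instance [Finite F] : TopologicalSpace.SeparableSpace (RankCompletion F) :=
  inferInstanceAs (TopologicalSpace.SeparableSpace (Completion (RankLimit F)))

instance [Finite F] : PolishSpace (RankCompletion F) := by
  have := UniformSpace.secondCountable_of_separable (RankCompletion F)
  infer_instance

/-- The Borel σ-algebra. -/
instance : MeasurableSpace (RankCompletion F) := borel _

instance : BorelSpace (RankCompletion F) := ⟨rfl⟩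

/-- The canonical map `A₀(F) → A(F)`. -/
def coe (x : RankLimit F) : RankCompletion F := (x : Completion (RankLimit F))

theorem dist_coe (x y : RankLimit F) : dist (coe x) (coe y) = dist x y :=
  Completion.dist_eq x y

theorem denseRange_coe : DenseRange (coe : RankLimit F → RankCompletion F) :=
  Completion.denseRange_coe

theorem continuous_coe : Continuous (coe : RankLimit F → RankCompletion F) :=
  Completion.continuous_coe _

instance : Mul (RankCompletion F) := ⟨Completion.map₂ (fun x y : RankLimit F => x * y)⟩

instance : Inv (RankCompletion F) := ⟨Completion.map (fun x : RankLimit F => x⁻¹)⟩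

instance : One (RankCompletion F) := ⟨coe 1⟩

theorem coe_mul (x y : RankLimit F) : coe (x * y) = coe x * coe y :=
  (Completion.map₂_coe_coe x y _ RankLimit.uniformContinuous_mul).symm

theorem coe_inv (x : RankLimit F) : coe x⁻¹ = (coe x)⁻¹ :=
  (Completion.map_coe RankLimit.uniformContinuous_inv x).symm

theorem coe_one : coe (1 : RankLimit F) = 1 := rfl

instance : ContinuousMul (RankCompletion F) :=
  ⟨Completion.continuous_map₂ continuous_fst continuous_snd⟩

instance : ContinuousInv (RankCompletion F) := ⟨Completion.continuous_map⟩

/-- The group operations of `A₀(F)`, extended by continuity. -/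
instance : Group (RankCompletion F) where
  mul_assoc a b c := by
    refine Completion.induction_on₃ (p := fun a b c : RankCompletion F => a * b * c = a * (b * c))
      a b c (isClosed_eq (by fun_prop) (by fun_prop)) fun x y z => ?_
    change coe x * coe y * coe z = coe x * (coe y * coe z)
    simp only [← coe_mul, mul_assoc]
  one_mul a := by
    refine Completion.induction_on (p := fun a : RankCompletion F => 1 * a = a)
      a (isClosed_eq (by fun_prop) (by fun_prop)) fun x => ?_
    change 1 * coe x = coe x
    rw [← coe_one, ← coe_mul, one_mul]
  mul_one a := by
    refine Completion.induction_on (p := fun a : RankCompletion F => a * 1 = a)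
      a (isClosed_eq (by fun_prop) (by fun_prop)) fun x => ?_
    change coe x * 1 = coe x
    rw [← coe_one, ← coe_mul, mul_one]
  inv_mul_cancel a := by
    refine Completion.induction_on (p := fun a : RankCompletion F => a⁻¹ * a = 1)
      a (isClosed_eq (by fun_prop) (by fun_prop)) fun x => ?_
    change (coe x)⁻¹ * coe x = 1
    rw [← coe_inv, ← coe_mul, inv_mul_cancel, coe_one]

instance : IsTopologicalGroup (RankCompletion F) where

instance : IsIsometricSMul (RankCompletion F) (RankCompletion F) :=
  ⟨fun c => Isometry.of_dist_eq fun a b => by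
    refine Completion.induction_on₃
      (p := fun a b c : RankCompletion F => dist (c * a) (c * b) = dist a b)
      a b c (isClosed_eq (by fun_prop) (by fun_prop)) fun x y z => ?_
    change dist (coe z * coe x) (coe z * coe y) = dist (coe x) (coe y)
    rw [← coe_mul, ← coe_mul, dist_coe, dist_coe, dist_mul_left]⟩

instance : IsIsometricSMul (RankCompletion F)ᵐᵒᵖ (RankCompletion F) :=
  ⟨fun c => Isometry.of_dist_eq fun a b => by
    refine Completion.induction_on₃
      (p := fun a b c : RankCompletion F => dist (a * c) (b * c) = dist a b)
      a b c.unop (isClosed_eq (by fun_prop) (by fun_prop)) fun x y z => ?_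
    change dist (coe x * coe z) (coe y * coe z) = dist (coe x) (coe y)
    rw [← coe_mul, ← coe_mul, dist_coe, dist_coe, dist_mul_right]⟩

end RankCompletion

end

/-! Concentration is measured by the variance of 1-Lipschitz functions under the uniform
distribution. In `SL_n` let `G_k` be the stabilizer of the first `k` basis vectors; these subgroups
descend from the whole group to the trivial one in `n` steps. For `g ∈ G_k` the next basis vector
can be moved to its image under `g` by an element of `G_k` within `2 / n` of `1`, so every left
coset of `G_{k+1}` in `G_k` meets that ball. By the law of total variance each step adds at most `(2
/ n) ^ 2`, so the variance on `SL_n` is at most `4 / n` (`of_subgroup_le`,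
`RankSL.lipschitzVarianceLE`). Chebyshev's inequality turns this into the Lévy property, which the
isometric copies of `SL_{2^n}` in the completion inherit.

For extreme amenability, an orbit function `g ↦ F (g • x₀)` is uniformly continuous, hence nearly
constant in mean square on the large finite subgroups, and left translation barely changes it on
average. So some orbit point is almost invariant for finitely many functions and group elements at
once, and compactness yields a fixed point. -/

open scoped BigOperators

/-! ### Variance of Lipschitz functions on finite metric spaces -/

/-- Every `1`-Lipschitz function on the finite metric space `X` has variance at most `v` with
respect to the uniform distribution. -/
def LipschitzVarianceLE (X : Type*) [Fintype X] [PseudoMetricSpace X] (v : ℝ) : Prop :=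
  ∀ f : X → ℝ, (∀ x y, |f x - f y| ≤ dist x y) → 𝔼 x, f x ^ 2 - (𝔼 x, f x) ^ 2 ≤ v

theorem expect_sub_const_sq {X : Type*} [Fintype X] [Nonempty X] (f : X → ℝ) (a : ℝ) :
    𝔼 x, (f x - a) ^ 2 = (𝔼 x, f x ^ 2 - (𝔼 x, f x) ^ 2) + (𝔼 x, f x - a) ^ 2 := by
  have h : ∀ x, (f x - a) ^ 2 = f x ^ 2 - 2 * a * f x + a ^ 2 := fun x => by ring
  simp only [h]
  rw [Finset.expect_add_distrib, Finset.expect_sub_distrib, ← Finset.mul_expect,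
    Fintype.expect_const]
  ring

theorem variance_le_of_abs_sub_le {X : Type*} [Fintype X] [Nonempty X] (f : X → ℝ) {a c : ℝ}
    (h : ∀ x, |f x - a| ≤ c) : 𝔼 x, f x ^ 2 - (𝔼 x, f x) ^ 2 ≤ c ^ 2 := by
  have h1 : 𝔼 x, (f x - a) ^ 2 ≤ c ^ 2 := by
    rw [← Fintype.expect_const (ι := X) (c ^ 2)]
    refine Finset.expect_le_expect fun x _ => ?_
    rw [← sq_abs]
    exact pow_le_pow_left₀ (abs_nonneg _) (h x) 2
  have h2 := expect_sub_const_sq f a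
  have h3 := sq_nonneg (𝔼 x, f x - a)
  linarith

namespace LipschitzVarianceLE

theorem nonneg {X : Type*} [Fintype X] [Nonempty X] [PseudoMetricSpace X] {v : ℝ}
    (h : LipschitzVarianceLE X v) : 0 ≤ v := by
  have := h (fun _ => 0) (fun x y => by simp)
  simpa using this

theorem mono {X : Type*} [Fintype X] [PseudoMetricSpace X] {v w : ℝ}
    (h : LipschitzVarianceLE X v) (hvw : v ≤ w) : LipschitzVarianceLE X w :=
  fun f hf => (h f hf).trans hvw

theorem of_isometryEquiv {X Y : Type*} [Fintype X] [Fintype Y] [PseudoMetricSpace X]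
    [PseudoMetricSpace Y] {v : ℝ} (h : LipschitzVarianceLE X v) (e : X ≃ᵢ Y) :
    LipschitzVarianceLE Y v := by
  intro f hf
  have := h (f ∘ e) (fun x y => (hf _ _).trans (e.isometry.dist_eq x y).le)
  rwa [Fintype.expect_equiv e.toEquiv (fun x => (f ∘ e) x) f fun _ => rfl,
    Fintype.expect_equiv e.toEquiv (fun x => (f ∘ e) x ^ 2) (fun y => f y ^ 2) fun _ => rfl]
    at this

theorem of_lipschitz {X : Type*} [Fintype X] [Nonempty X] [PseudoMetricSpace X] {v : ℝ}
    (h : LipschitzVarianceLE X v) (f : X → ℝ) {L : ℝ} (hL : 0 < L)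
    (hf : ∀ x y, |f x - f y| ≤ L * dist x y) :
    𝔼 x, (f x - 𝔼 y, f y) ^ 2 ≤ L ^ 2 * v := by
  have h1 := h (fun x => L⁻¹ * f x) fun x y => by
    rw [← mul_sub, abs_mul, abs_of_pos (inv_pos.2 hL), inv_mul_le_iff₀ hL]
    exact hf x y
  simp only [mul_pow] at h1
  rw [← Finset.mul_expect, ← Finset.mul_expect, mul_pow, ← mul_sub, inv_pow,
    inv_mul_le_iff₀ (by positivity)] at h1
  rw [expect_sub_const_sq]
  simpa using h1

/-- Passing from a subgroup `K` to a larger one `H` all of whose cosets of `K` meet the ball of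
radius `c` about `1` increases the variance by at most `c ^ 2`. -/
theorem of_subgroup_le {G : Type*} [Group G] [PseudoMetricSpace G] [IsIsometricSMul G G]
    [IsIsometricSMul Gᵐᵒᵖ G] {K H : Subgroup G} [Fintype K] [Fintype H] (hKH : K ≤ H) {v c : ℝ}
    (hK : LipschitzVarianceLE K v) (hc : ∀ g ∈ H, ∃ k ∈ K, dist (g * k) 1 ≤ c) :
    LipschitzVarianceLE H (v + c ^ 2) := by
  intro f hf
  let ι : K →* H := Subgroup.inclusion hKH
  have hι : ∀ k : K, ((ι k : H) : G) = k := fun _ => rfl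
  -- `φ` is the conditional expectation of `f` on left cosets of `K`. The variance of `f` is the
  -- mean variance inside the cosets (`hfib`) plus the variance of `φ` (`hφ`).
  let φ : H → ℝ := fun g => 𝔼 k : K, f (g * ι k)
  have avg : ∀ F : H → ℝ, 𝔼 g, F g = 𝔼 g, 𝔼 k : K, F (g * ι k) := by
    intro F
    rw [Finset.expect_comm, ← Fintype.expect_const (ι := K) (𝔼 g, F g)]
    exact Finset.expect_congr rfl fun k _ =>
      (Fintype.expect_equiv (Equiv.mulRight (ι k)) _ _ fun _ => rfl).symm
  have hfib : ∀ g, 𝔼 k : K, f (g * ι k) ^ 2 - φ g ^ 2 ≤ v := fun g =>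
    hK (fun k => f (g * ι k)) fun x y => (hf _ _).trans <| by
      rw [Subtype.dist_eq, Subtype.dist_eq]
      simp [hι]
  have hφ : ∀ g, |φ g - φ 1| ≤ c := by
    intro g
    obtain ⟨k, hk, hd⟩ := hc g g.2
    -- `φ g` depends only on the coset, so the representative `g * k` near `1` may be used; right
    -- invariance keeps `g * k * x` equally near `x`.
    have e : φ g = 𝔼 x : K, f (g * ι ⟨k, hk⟩ * ι x) :=
      (Fintype.expect_equiv (Equiv.mulLeft (⟨k, hk⟩ : K)) _ _ fun x => by
        simp [mul_assoc]).symm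
    rw [e, ← Finset.expect_sub_distrib]
    refine (Finset.abs_expect_le _ _).trans ?_
    rw [← Fintype.expect_const (ι := K) c]
    refine Finset.expect_le_expect fun x _ => (hf _ _).trans ?_
    rw [Subtype.dist_eq]
    rw [← dist_mul_right _ _ (x : G)] at hd
    simpa [hι] using hd
  have h1 := variance_le_of_abs_sub_le φ hφ
  have h2 : 𝔼 g, (𝔼 k : K, f (g * ι k) ^ 2 - φ g ^ 2) ≤ v := by
    rw [← Fintype.expect_const (ι := H) v]
    exact Finset.expect_le_expect fun g _ => hfib g
  rw [Finset.expect_sub_distrib] at h2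
  rw [avg f, avg fun g => f g ^ 2]
  change _ - (𝔼 g, φ g) ^ 2 ≤ _
  linarith

end LipschitzVarianceLE

/-! ### From variance to concentration -/

theorem uniformOn_univ_real {X : Type*} [Fintype X] [MeasurableSpace X]
    [MeasurableSingletonClass X] (s : Set X) :
    (ProbabilityTheory.uniformOn (Set.univ : Set X)).real s = 𝔼 x, s.indicator 1 x := by
  classical
  rw [measureReal_def, ProbabilityTheory.uniformOn_univ, Fintype.expect_eq_sum_div_card,
    Measure.count_apply s.toFinite.measurableSet, ENNReal.toReal_div,
    ← Set.coe_toFinset s, Set.encard_coe_eq_coe_finsetCard]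
  simp [Set.indicator_apply]

theorem concentrationFunction_nonneg {X : Type*} [MetricSpace X] [MeasurableSpace X]
    (μ : Measure X) [IsProbabilityMeasure μ] (r : ℝ) : 0 ≤ concentrationFunction μ r := by
  refine Real.sSup_nonneg ?_
  rintro _ ⟨A, -, -, rfl⟩
  exact sub_nonneg.2 measureReal_le_one

/-- Chebyshev for the distance `f` to `A`. Since `f` vanishes on a set of mass at least `1 / 2`, its
mean `m` satisfies `m ^ 2 / 2 ≤ v`; hence the second moment of `f` is at most `v + 2 * v`, and `f ≥
r` off the thickening. -/
theorem LipschitzVarianceLE.concentrationFunction_le {X : Type*} [Fintype X] [Nonempty X]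
    [MetricSpace X] [MeasurableSpace X] [BorelSpace X] {v : ℝ} (h : LipschitzVarianceLE X v)
    {r : ℝ} (hr : 0 < r) :
    concentrationFunction (ProbabilityTheory.uniformOn (Set.univ : Set X)) r ≤ 3 * v / r ^ 2 := by
  have hv := h.nonneg
  refine Real.sSup_le ?_ (by positivity)
  rintro _ ⟨A, -, hA, rfl⟩
  rw [uniformOn_univ_real] at hA ⊢
  have hne : A.Nonempty := by
    by_contra hA'
    rw [Set.not_nonempty_iff_eq_empty.1 hA'] at hA
    norm_num at hA
  let f : X → ℝ := fun x => Metric.infDist x A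
  have hf := h f fun x y => by
    simpa [Real.dist_eq] using (Metric.lipschitz_infDist_pt A).dist_le_mul x y
  set m := 𝔼 x, f x with hm
  have h1 : 𝔼 x, A.indicator 1 x * m ^ 2 ≤ 𝔼 x, (f x - m) ^ 2 := by
    refine Finset.expect_le_expect fun x _ => ?_
    by_cases hx : x ∈ A
    · simp [hx, f, Metric.infDist_zero_of_mem hx]
    · simp [hx, sq_nonneg]
  rw [← Finset.expect_mul, expect_sub_const_sq, ← hm, sub_self] at h1
  have h2 : m ^ 2 ≤ 2 * v := by nlinarith [sq_nonneg m]
  have h3 : 𝔼 x, (1 - (Metric.thickening r A).indicator 1 x) * r ^ 2 ≤ 𝔼 x, f x ^ 2 := by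
    refine Finset.expect_le_expect fun x _ => ?_
    by_cases hx : x ∈ Metric.thickening r A
    · simp [hx, sq_nonneg]
    · have : r ≤ f x := by
        by_contra! hlt
        exact hx (Metric.mem_thickening_iff.2 ((Metric.infDist_lt_iff hne).1 hlt))
      simpa [hx] using pow_le_pow_left₀ hr.le this 2
  rw [← Finset.expect_mul, Finset.expect_sub_distrib, Fintype.expect_const] at h3
  rw [le_div_iff₀ (by positivity)]
  linarith

theorem tendsto_concentrationFunction {X : ℕ → Type*} [∀ n, Fintype (X n)] [∀ n, Nonempty (X n)]
    [∀ n, MetricSpace (X n)] [∀ n, MeasurableSpace (X n)] [∀ n, BorelSpace (X n)] {v : ℕ → ℝ}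
    (h : ∀ n, LipschitzVarianceLE (X n) (v n)) (hv : Tendsto v atTop (𝓝 0)) {r : ℝ}
    (hr : 0 < r) :
    Tendsto (fun n => concentrationFunction
      (ProbabilityTheory.uniformOn (Set.univ : Set (X n))) r) atTop (𝓝 0) := by
  refine squeeze_zero (fun n => concentrationFunction_nonneg _ r)
    (fun n => (h n).concentrationFunction_le hr) ?_
  simpa using (hv.const_mul 3).div_const (r ^ 2)

/-! ### Concentration implies extreme amenability -/

/-- A bounded uniformly continuous function on a finite metric space is uniformly close to a
Lipschitz one, its infimal convolution with a multiple of the distance. -/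
theorem exists_lipschitz_approx {X : Type*} [Finite X] [Nonempty X] [PseudoMetricSpace X]
    (f : X → ℝ) {ε δ M : ℝ} (hδ : 0 < δ) (hM : ∀ x, |f x| ≤ M)
    (hf : ∀ x y, dist x y < δ → |f x - f y| ≤ ε) :
    ∃ f' : X → ℝ, (∀ x, |f' x - f x| ≤ ε) ∧
      ∀ x y, |f' x - f' y| ≤ 2 * M / δ * dist x y := by
  have hM0 : 0 ≤ M := (abs_nonneg _).trans (hM (Classical.arbitrary X))
  have hε : 0 ≤ ε := by simpa [hδ] using hf (Classical.arbitrary X) (Classical.arbitrary X)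
  -- With this slope, points at distance at least `δ` pay `2 * M`, the largest possible oscillation
  -- of `f`, so they cannot lower the infimum below `f x`.
  set L := 2 * M / δ with hL
  have hL0 : 0 ≤ L := by positivity
  let f' : X → ℝ := fun x => ⨅ y, (f y + L * dist x y)
  have hle : ∀ x y, f' x ≤ f y + L * dist x y := fun x y => ciInf_le (Set.finite_range _).bddBelow y
  have key : ∀ x y, f' x - f' y ≤ L * dist x y := by
    intro x y
    suffices f' x - L * dist x y ≤ f' y by linarith
    refine le_ciInf fun z => ?_
    have h1 := hle x z
    have h2 := mul_le_mul_of_nonneg_left (dist_triangle x y z) hL0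
    linarith
  refine ⟨f', fun x => abs_le.2 ⟨?_, ?_⟩, fun x y => abs_le.2 ⟨?_, key x y⟩⟩
  · suffices f x - ε ≤ f' x by linarith
    refine le_ciInf fun y => ?_
    rcases lt_or_ge (dist x y) δ with h | h
    · have := (abs_le.1 (hf x y h)).2
      have := mul_nonneg hL0 (dist_nonneg (x := x) (y := y))
      linarith
    · have h1 : 2 * M ≤ L * dist x y := by
        rw [hL, div_mul_eq_mul_div, le_div_iff₀ hδ]
        exact mul_le_mul_of_nonneg_left h (by positivity)
      have := (abs_le.1 (hM x)).2
      have := (abs_le.1 (hM y)).1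
      linarith
  · have := hle x x
    rw [dist_self, mul_zero] at this
    linarith
  · have := key y x
    rw [dist_comm] at this
    linarith

/-- The size of `s` plays no role: the Lipschitz approximant and its translate have the same
distribution, so both are close in mean square to the same constant `m`. -/
theorem LipschitzVarianceLE.expect_translate_sub_sq_le {H : Type*} [Group H] [Fintype H]
    [PseudoMetricSpace H] {v : ℝ} (h : LipschitzVarianceLE H v) (f : H → ℝ) {ε δ M : ℝ}
    (hδ : 0 < δ) (hM0 : 0 < M) (hM : ∀ x, |f x| ≤ M)
    (hf : ∀ x y, dist x y < δ → |f x - f y| ≤ ε) (s : H) :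
    𝔼 g, (f (s * g) - f g) ^ 2 ≤ 6 * ((2 * M / δ) ^ 2 * v) + 12 * ε ^ 2 := by
  obtain ⟨f', hff', hf'⟩ := exists_lipschitz_approx f hδ hM hf
  have hvar := h.of_lipschitz f' (by positivity) hf'
  set m := 𝔼 y, f' y
  have hvar' : 𝔼 g, (f' (s * g) - m) ^ 2 ≤ (2 * M / δ) ^ 2 * v := by
    rwa [Fintype.expect_equiv (Equiv.mulLeft s) (fun g => (f' (s * g) - m) ^ 2)
      (fun g => (f' g - m) ^ 2) fun _ => rfl]
  have hpt : ∀ g, (f (s * g) - f g) ^ 2 ≤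
      3 * (f' (s * g) - m) ^ 2 + 3 * (f' g - m) ^ 2 + 12 * ε ^ 2 := by
    intro g
    have h1 := abs_le.1 (hff' (s * g))
    have h2 := abs_le.1 (hff' g)
    set a := f' (s * g) - m
    set b := f' g - m
    set e := (f' g - f g) - (f' (s * g) - f (s * g))
    have e1 : f (s * g) - f g = a - b + e := by simp only [a, b, e]; ring
    have e2 : e ^ 2 ≤ (2 * ε) ^ 2 := sq_le_sq' (by linarith) (by linarith)
    rw [e1]
    -- This is `(a - b + e) ^ 2 ≤ 3 * (a ^ 2 + b ^ 2 + e ^ 2)`.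
    nlinarith [sq_nonneg (a + b), sq_nonneg (a - e), sq_nonneg (b + e)]
  refine (Finset.expect_le_expect fun g _ => hpt g).trans ?_
  rw [Finset.expect_add_distrib, Finset.expect_add_distrib, ← Finset.mul_expect,
    ← Finset.mul_expect, Fintype.expect_const]
  linarith

theorem tendsto_expect_translate_sub_sq {G : Type*} [Group G] [PseudoMetricSpace G]
    (H : ℕ → Subgroup G) [∀ n, Fintype (H n)] {v : ℕ → ℝ} (hv : Tendsto v atTop (𝓝 0))
    (h : ∀ n, LipschitzVarianceLE (H n) (v n)) (f : G → ℝ) (hf : UniformContinuous f) {M : ℝ}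
    (hM : ∀ x, |f x| ≤ M) {s : G} (hs : ∀ᶠ n in atTop, s ∈ H n) :
    Tendsto (fun n => 𝔼 g : H n, (f (s * g) - f g) ^ 2) atTop (𝓝 0) := by
  -- `M` may be `0`, while the Lipschitz constant must be positive.
  have hM0 : 0 < M + 1 := by linarith [(abs_nonneg _).trans (hM 1)]
  rw [Metric.tendsto_nhds]
  intro η hη
  obtain ⟨ε, hε, hεη⟩ : ∃ ε : ℝ, 0 < ε ∧ 12 * ε ^ 2 < η := by
    have : Tendsto (fun ε : ℝ => 12 * ε ^ 2) (𝓝[>] 0) (𝓝 0) := by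
      have : Tendsto (fun ε : ℝ => 12 * ε ^ 2) (𝓝 0) (𝓝 (12 * 0 ^ 2)) :=
        Continuous.tendsto (by fun_prop) 0
      simpa using this.mono_left nhdsWithin_le_nhds
    obtain ⟨ε, h1, h2⟩ := ((this.eventually_lt_const hη).and self_mem_nhdsWithin).exists
    exact ⟨ε, h2, h1⟩
  obtain ⟨δ, hδ, hfδ⟩ := Metric.uniformContinuous_iff.1 hf ε hε
  have hlim : Tendsto (fun n => 6 * ((2 * (M + 1) / δ) ^ 2 * v n) + 12 * ε ^ 2) atTop
      (𝓝 (12 * ε ^ 2)) := by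
    simpa using ((hv.const_mul ((2 * (M + 1) / δ) ^ 2)).const_mul 6).add_const (12 * ε ^ 2)
  filter_upwards [hs, hlim.eventually_lt_const hεη] with n hsn hn
  have := (h n).expect_translate_sub_sq_le (fun g => f g) hδ hM0
    (fun x => (hM x).trans (by linarith)) (fun x y hxy => (hfδ hxy).le) ⟨s, hsn⟩
  rw [Real.dist_eq, sub_zero, abs_of_nonneg (Finset.expect_nonneg fun g _ => sq_nonneg _)]
  exact this.trans_lt hn

/-- By compactness of `X`, elements near `1` change `F` little uniformly on `X`; right invariance
says that `a * b⁻¹` is near `1` when `a` is near `b`. -/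
theorem uniformContinuous_orbit_comp {G : Type*} [Group G] [PseudoMetricSpace G]
    [IsIsometricSMul Gᵐᵒᵖ G] {X : Type*} [TopologicalSpace X] [CompactSpace X] [MulAction G X]
    [ContinuousSMul G X] (F : C(X, ℝ)) (x : X) : UniformContinuous fun g : G => F (g • x) := by
  rw [Metric.uniformContinuous_iff]
  intro ε hε
  have h : ∀ᶠ w in 𝓝 (1 : G), ∀ y ∈ (Set.univ : Set X), dist (F (w • y)) (F y) < ε := by
    refine isCompact_univ.eventually_forall_of_forall_eventually fun y _ => ?_
    have hc : Continuous fun p : G × X => dist (F (p.1 • p.2)) (F p.2) := by fun_prop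
    exact hc.continuousAt.eventually_lt_const (by simpa using hε)
  obtain ⟨δ, hδ, hball⟩ := Metric.eventually_nhds_iff.1 h
  refine ⟨δ, hδ, fun {a b} hab => ?_⟩
  have := hball (y := a * b⁻¹) (by
    rwa [← dist_mul_right (a * b⁻¹) 1 b, inv_mul_cancel_right, one_mul]) (b • x) trivial
  rwa [smul_smul, inv_mul_cancel_right] at this

theorem isExtremelyAmenable_of_lipschitzVarianceLE {G : Type u} [Group G] [MetricSpace G]
    [IsIsometricSMul Gᵐᵒᵖ G] (H : ℕ → Subgroup G) [∀ n, Fintype (H n)]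
    (hmono : Monotone H) (hdense : Dense (⋃ n, (H n : Set G))) {v : ℕ → ℝ}
    (hv : Tendsto v atTop (𝓝 0)) (h : ∀ n, LipschitzVarianceLE (H n) (v n)) :
    IsExtremelyAmenable.{u, v} G := by
  intro X _ _ _ _ _ _
  let x₀ : X := Classical.arbitrary X
  let K : C(X, ℝ) × (⋃ n, (H n : Set G) : Set G) → Set X := fun p =>
    {x | |p.1 ((p.2 : G) • x) - p.1 x| ≤ 1}
  have hclosed : ∀ p, IsClosed (K p) := fun p => isClosed_le (by fun_prop) (by fun_prop)
  have hfip : ∀ S : Finset (C(X, ℝ) × (⋃ n, (H n : Set G) : Set G)),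
      (⋂ p ∈ S, K p).Nonempty := by
    intro S
    -- Summing over `S` before choosing `g` makes one `g` work for all pairs in `S`.
    have hlim : Tendsto (fun n => ∑ p ∈ S, 𝔼 g : H n,
        (p.1 (((p.2 : G) * g) • x₀) - p.1 ((g : G) • x₀)) ^ 2) atTop (𝓝 0) := by
      rw [← Finset.sum_const_zero (s := S)]
      refine tendsto_finsetSum _ fun p _ => ?_
      obtain ⟨N, hN⟩ := Set.mem_iUnion.1 p.2.2
      exact tendsto_expect_translate_sub_sq H hv h (fun g => p.1 (g • x₀))
        (uniformContinuous_orbit_comp p.1 x₀)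
        (M := ‖p.1‖) (fun g => p.1.norm_coe_le_norm _)
        (eventually_atTop.2 ⟨N, fun n hn => hmono hn hN⟩)
    obtain ⟨n, hn⟩ := (hlim.eventually_lt_const one_pos).exists
    rw [← Finset.expect_sum_comm] at hn
    obtain ⟨g, -, hg⟩ := Finset.exists_lt_of_expect_lt Finset.univ_nonempty hn
    refine ⟨(g : G) • x₀, Set.mem_iInter₂.2 fun p hp => ?_⟩
    have hle := (Finset.single_le_sum (f := fun p : C(X, ℝ) × (⋃ n, (H n : Set G) : Set G) =>
      (p.1 (((p.2 : G) * g) • x₀) - p.1 ((g : G) • x₀)) ^ 2)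
      (fun _ _ => sq_nonneg _) hp).trans hg.le
    change |p.1 ((p.2 : G) • (g : G) • x₀) - p.1 ((g : G) • x₀)| ≤ 1
    rw [smul_smul]
    exact (sq_le_one_iff_abs_le_one _).1 hle
  obtain ⟨x, hx⟩ := CompactSpace.iInter_nonempty hclosed hfip
  have hfix : ∀ g ∈ ⋃ n, (H n : Set G), g • x = x := by
    intro g hg
    by_contra hne
    obtain ⟨F, hF0, hF1, -⟩ := exists_continuous_zero_one_of_isClosed
      (isClosed_singleton (x := g • x)) (isClosed_singleton (x := x))
      (Set.disjoint_singleton.2 hne)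
    -- The tolerance `1` in `K` is enough because functions can be rescaled: `2 • F` separates the
    -- two points by `2`.
    have := Set.mem_iInter.1 hx ((2 : ℝ) • F, ⟨g, hg⟩)
    have h0 : F (g • x) = 0 := hF0 rfl
    have h1 : F x = 1 := hF1 rfl
    simp [K, h0, h1] at this
  refine ⟨x, fun g => ?_⟩
  have hcl : IsClosed {g : G | g • x = x} := isClosed_eq (by fun_prop) (by fun_prop)
  exact hcl.closure_subset_iff.2 hfix (hdense g)

/-! ### Concentration in special linear groups -/

namespace RankSL

open Matrix

variable {F : Type u} [Field F] {n : ℕ}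

/-- The pointwise stabilizer in `SL_n(F)` of the first `k` standard basis vectors. -/
def basisStabilizer (F : Type u) [Field F] (n k : ℕ) : Subgroup (RankSL F n) where
  carrier := {g | ∀ j : Fin n, j.val < k → g.toMatrix *ᵥ Pi.single j 1 = Pi.single j 1}
  mul_mem' {g h} hg hh j hj := by rw [toMatrix_mul, ← mulVec_mulVec, hh j hj, hg j hj]
  one_mem' j _ := by rw [toMatrix_one, one_mulVec]
  inv_mem' {g} hg j hj := by
    conv_lhs => rw [← hg j hj]
    rw [mulVec_mulVec, ← toMatrix_mul, inv_mul_cancel, toMatrix_one, one_mulVec]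

theorem basisStabilizer_zero : basisStabilizer F n 0 = ⊤ :=
  eq_top_iff.2 fun _ _ _ hj => absurd hj (Nat.not_lt_zero _)

theorem basisStabilizer_succ_le (k : ℕ) : basisStabilizer F n (k + 1) ≤ basisStabilizer F n k :=
  fun _ hg j hj => hg j (hj.trans k.lt_succ_self)

theorem eq_of_mulVec_single_eq {g h : RankSL F n}
    (H : ∀ j, g.toMatrix *ᵥ Pi.single j 1 = h.toMatrix *ᵥ Pi.single j 1) : g = h := by
  refine toMatrix_injective (Matrix.ext fun i j => ?_)
  simpa using congrFun (H j) i

theorem basisStabilizer_self : basisStabilizer F n n = ⊥ :=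
  eq_bot_iff.2 fun g hg => Subgroup.mem_bot.2 <| eq_of_mulVec_single_eq fun j => by
    rw [hg j j.2, toMatrix_one, one_mulVec]

theorem det_one_add_vecMulVec (u φ : Fin n → F) : (1 + vecMulVec u φ).det = 1 + φ ⬝ᵥ u := by
  rw [vecMulVec_eq Unit, det_one_add_replicateCol_mul_replicateRow]

/-- The rank one perturbation `1 + u φ` of the identity, where `φ u = 0`. -/
def transvection (u φ : Fin n → F) (h : φ ⬝ᵥ u = 0) : RankSL F n :=
  ⟨1 + vecMulVec u φ, by rw [det_one_add_vecMulVec, h, add_zero]⟩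

theorem toMatrix_transvection (u φ : Fin n → F) (h : φ ⬝ᵥ u = 0) :
    (transvection u φ h).toMatrix = 1 + vecMulVec u φ := rfl

theorem transvection_mulVec (u φ : Fin n → F) (h : φ ⬝ᵥ u = 0) (w : Fin n → F) :
    (transvection u φ h).toMatrix *ᵥ w = w + (φ ⬝ᵥ w) • u := by
  rw [toMatrix_transvection, add_mulVec, one_mulVec, vecMulVec_mulVec, op_smul_eq_smul]

theorem dist_le_of_toMatrix_sub_eq {g h : RankSL F n} {u φ : Fin n → F}
    (hgh : g.toMatrix - h.toMatrix = vecMulVec u φ) : dist g h ≤ 1 / n := by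
  rw [dist_def, hgh]
  gcongr
  exact_mod_cast rank_vecMulVec_le u φ

theorem dist_transvection_one_le (u φ : Fin n → F) (h : φ ⬝ᵥ u = 0) :
    dist (transvection u φ h) 1 ≤ 1 / n :=
  dist_le_of_toMatrix_sub_eq (u := u) (φ := φ) <| by
    rw [toMatrix_transvection, toMatrix_one, add_sub_cancel_left]

theorem dist_mul_one_le {G : Type*} [Group G] [PseudoMetricSpace G] [IsIsometricSMul Gᵐᵒᵖ G]
    (a b : G) : dist (a * b) 1 ≤ dist a 1 + dist b 1 := by
  have := dist_triangle (a * b) (1 * b) 1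
  rwa [dist_mul_right, one_mul] at this

/-- A vector with a nonzero coordinate beyond the `k`-th is the image of the `k`-th basis vector
under a transvection fixing the previous ones. -/
theorem exists_transvection_of_ne_zero {k j : Fin n} (hkj : k < j) (v : Fin n → F)
    (hv : v j ≠ 0) : ∃ x ∈ basisStabilizer F n k,
      x.toMatrix *ᵥ Pi.single k 1 = v ∧ dist x 1 ≤ 1 / n := by
  -- `φ` takes the value `1` on both the `k`-th basis vector and `v`, and kills the basis vectors
  -- before the `k`-th.
  let φ : Fin n → F := Pi.single k 1 + Pi.single j ((1 - v k) / v j)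
  have hφ : φ ⬝ᵥ (v - Pi.single k 1) = 0 := by
    simp [φ, hkj.ne, div_mul_cancel₀ _ hv]
  refine ⟨transvection _ φ hφ, fun i hi => ?_, ?_, dist_transvection_one_le _ _ _⟩
  · have hik : i ≠ k := fun h => by simp [h] at hi
    have hij : i ≠ j := fun h => by
      rw [h] at hi
      exact absurd hkj (not_lt.2 (Fin.le_def.2 hi.le))
    rw [transvection_mulVec]
    simp [φ, hik, hij]
  · rw [transvection_mulVec]
    simp [φ, hkj.ne]

/-- If the target `v` has a nonzero coordinate beyond `k`, one transvection suffices. Otherwise, if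
there is room, a detour through `v` plus the next basis vector costs two, whence `2 / n`. For `k = n
- 1`, `g` itself differs from `1` only in its last column. -/
theorem exists_mem_basisStabilizer_dist_le {k : ℕ} (hk : k < n) (g : RankSL F n)
    (hg : g ∈ basisStabilizer F n k) :
    ∃ x ∈ basisStabilizer F n k, x.toMatrix *ᵥ Pi.single ⟨k, hk⟩ 1 =
      g.toMatrix *ᵥ Pi.single ⟨k, hk⟩ 1 ∧ dist x 1 ≤ 2 / n := by
  have h12 : (1 : ℝ) / n ≤ 2 / n := by gcongr; norm_num
  set κ : Fin n := ⟨k, hk⟩ with hκ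
  set v := g.toMatrix *ᵥ Pi.single κ 1 with hv
  by_cases hex : ∃ j, κ < j ∧ v j ≠ 0
  · obtain ⟨j, hj, hvj⟩ := hex
    obtain ⟨x, hx, hxv, hd⟩ := exists_transvection_of_ne_zero hj v hvj
    exact ⟨x, hx, hxv, hd.trans h12⟩
  push Not at hex
  by_cases hlast : k + 1 < n
  -- Otherwise `v` lies in the span of the earlier basis vectors, so `g` fixes it; injectivity of
  -- `g` then makes `v` the `k`-th basis vector, a contradiction.
  · have hvk : v κ ≠ 0 := by
      intro h0
      have hgv : g.toMatrix *ᵥ v = v := by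
        have hsum : v = ∑ i, v i • (Pi.single i 1 : Fin n → F) := by
          ext i; simp [Finset.sum_apply, Pi.single_apply]
        conv_lhs => rw [hsum]
        conv_rhs => rw [hsum]
        rw [mulVec_sum]
        refine Finset.sum_congr rfl fun i _ => ?_
        rw [mulVec_smul]
        rcases lt_trichotomy i κ with h | h | h
        · rw [hg i h]
        · rw [h, h0, zero_smul, zero_smul]
        · rw [hex i h, zero_smul, zero_smul]
      have hinj : v = Pi.single κ 1 := by
        have := congrArg (fun w => (g⁻¹).toMatrix *ᵥ w) (hgv.trans hv)
        simpa only [mulVec_mulVec, ← toMatrix_mul, inv_mul_cancel, toMatrix_one, one_mulVec]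
          using this
      rw [hinj] at h0
      simp at h0
    let j : Fin n := ⟨k + 1, hlast⟩
    have hj : κ < j := Fin.lt_def.2 k.lt_succ_self
    obtain ⟨x, hx, hxv, hd⟩ := exists_transvection_of_ne_zero hj (v + Pi.single j 1)
      (by simp [hex j hj])
    -- Normalized so that `φ` is `1` on `v + Pi.single j 1`; the transvection then subtracts the
    -- auxiliary basis vector.
    let φ : Fin n → F := Pi.single κ (v κ)⁻¹
    have hφ : φ ⬝ᵥ (-Pi.single j 1) = 0 := by simp [φ, hj.ne']
    refine ⟨transvection _ φ hφ * x, mul_mem (fun i hi => ?_) hx, ?_, ?_⟩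
    · have hik : i ≠ κ := fun h => by simp [h, hκ] at hi
      rw [transvection_mulVec]
      simp [φ, hik]
    · rw [toMatrix_mul, ← mulVec_mulVec, hxv, transvection_mulVec]
      simp [φ, hj.ne, hvk]
    · refine (dist_mul_one_le _ _).trans ((add_le_add (dist_transvection_one_le _ _ _) hd).trans ?_)
      rw [← add_div]
      norm_num
  · refine ⟨g, hg, rfl, (dist_le_of_toMatrix_sub_eq (u := v - Pi.single κ 1)
      (φ := Pi.single κ 1) ?_).trans h12⟩
    ext a b
    have hb : b.val < k ∨ b = κ := by
      rcases lt_or_ge b.val k with h | h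
      · exact Or.inl h
      · exact Or.inr (Fin.ext (by have := b.2; simp only [hκ]; omega))
    rcases hb with hb | rfl
    · have hne : b ≠ κ := fun h => by simp [h, hκ] at hb
      have := congrFun (hg b hb) a
      simp only [mulVec_single_one, col_apply, Pi.single_apply] at this
      simp [toMatrix_one, vecMulVec_apply, hne, one_apply, this]
    · simp [toMatrix_one, vecMulVec_apply, hv, one_apply, Pi.single_apply]

/-- If `x` agrees with `g` on the `k`-th basis vector, then `g⁻¹ * x` fixes it, so `x` is a
representative of the coset of `g` near `1`. -/
theorem exists_mul_dist_one_le {k : ℕ} (hk : k < n) (g : RankSL F n)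
    (hg : g ∈ basisStabilizer F n k) :
    ∃ h ∈ basisStabilizer F n (k + 1), dist (g * h) 1 ≤ 2 / n := by
  obtain ⟨x, hx, hxv, hd⟩ := exists_mem_basisStabilizer_dist_le hk g hg
  refine ⟨g⁻¹ * x, fun j hj => ?_, by rwa [mul_inv_cancel_left]⟩
  rcases Nat.lt_succ_iff_lt_or_eq.1 hj with h | h
  · exact mul_mem (inv_mem hg) hx j h
  · obtain rfl : j = ⟨k, hk⟩ := Fin.ext h
    rw [toMatrix_mul, ← mulVec_mulVec, hxv, mulVec_mulVec, ← toMatrix_mul, inv_mul_cancel,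
      toMatrix_one, one_mulVec]

/-- Induction up the chain from the trivial group; `d` counts the basis vectors still free. -/
theorem lipschitzVarianceLE_basisStabilizer [Finite F] (d k : ℕ) (hdk : k + d = n)
    [Fintype (basisStabilizer F n k)] :
    LipschitzVarianceLE (basisStabilizer F n k) (d * (2 / n : ℝ) ^ 2) := by
  classical
  induction d generalizing k with
  | zero =>
    obtain rfl : k = n := by omega
    have : Subsingleton (basisStabilizer F k k) := by
      rw [basisStabilizer_self]; infer_instance
    intro f _
    have := variance_le_of_abs_sub_le f (a := f 1) (c := 0)
      fun x => by rw [Subsingleton.elim x 1, sub_self, abs_zero]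
    simpa using this
  | succ d ih =>
    let _ := Fintype.ofFinite (basisStabilizer F n (k + 1))
    refine ((ih (k + 1) (by omega)).of_subgroup_le (basisStabilizer_succ_le k)
      fun g hg => exists_mul_dist_one_le (by omega) g hg).mono (le_of_eq ?_)
    push_cast
    ring

theorem lipschitzVarianceLE [Finite F] (hn : 0 < n) [Fintype (RankSL F n)] :
    LipschitzVarianceLE (RankSL F n) (4 / n : ℝ) := by
  let _ := Fintype.ofFinite (basisStabilizer F n 0)
  have e : basisStabilizer F n 0 ≃ᵢ RankSL F n :=
    { toEquiv := (Equiv.subtypeUnivEquiv fun g => by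
        rw [basisStabilizer_zero]; trivial)
      isometry_toFun := isometry_subtype_coe }
  refine ((lipschitzVarianceLE_basisStabilizer n 0 (zero_add n)).of_isometryEquiv e).mono
    (le_of_eq ?_)
  have : (n : ℝ) ≠ 0 := by positivity
  field_simp
  norm_num

theorem dist_le_one (g h : RankSL F n) : dist g h ≤ 1 := by
  rw [dist_def]
  refine div_le_one_of_le₀ ?_ (Nat.cast_nonneg _)
  exact_mod_cast (rank_le_card_width _).trans (Fintype.card_fin n).le

/-- An element of `SL_2(F)` without eigenvalue `1`. -/
def fixedPointFree (F : Type u) [Field F] : RankSL F (2 ^ 1) :=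
  (⟨!![0, 1; -1, 1], by simp [det_fin_two]⟩ : SpecialLinearGroup (Fin 2) F)

/-- The difference with the identity has determinant `1` in every characteristic. -/
theorem dist_fixedPointFree_one : dist (fixedPointFree F) 1 = 1 := by
  have h : ((!![0, 1; -1, 1] : Matrix (Fin 2) (Fin 2) F) - 1).rank = 2 := by
    rw [rank_of_isUnit]
    · simp
    · rw [isUnit_iff_isUnit_det, det_fin_two]
      simp
  rw [dist_def]
  change (((!![0, 1; -1, 1] : Matrix (Fin 2) (Fin 2) F) - 1).rank : ℝ) / _ = 1
  rw [h]
  norm_num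

/-- The exponent starts at `1` because `SL_1` is trivial and has diameter `0`. -/
theorem exists_dist_eq_one (m : ℕ) : ∃ g h : RankSL F (2 ^ (m + 1)), dist g h = 1 :=
  ⟨transition F 1 (m + 1) (by omega) (fixedPointFree F), transition F 1 (m + 1) (by omega) 1, by
    rw [(isometry_transition 1 (m + 1) (by omega)).dist_eq, dist_fixedPointFree_one]⟩

theorem tendsto_four_div_two_pow : Tendsto (fun m : ℕ => (4 / (2 ^ (m + 1) : ℕ) : ℝ)) atTop (𝓝 0) :=
  tendsto_const_nhds.div_atTop <| tendsto_natCast_atTop_atTop.comp <|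
    (tendsto_pow_atTop_atTop_of_one_lt one_lt_two).comp (tendsto_add_atTop_nat 1)

end RankSL

theorem Metric.diam_univ_eq_one {X : Type*} [PseudoMetricSpace X] (h : ∀ x y : X, dist x y ≤ 1)
    (h' : ∃ x y : X, dist x y = 1) : Metric.diam (Set.univ : Set X) = 1 := by
  obtain ⟨x, y, hxy⟩ := h'
  refine le_antisymm (Metric.diam_le_of_forall_dist_le zero_le_one fun a _ b _ => h a b) ?_
  rw [← hxy]
  exact Metric.dist_le_diam_of_mem
    (Metric.isBounded_iff.2 ⟨1, fun a _ b _ => h a b⟩) trivial trivial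

theorem RankSL.isLevyFamily (F : Type u) [Field F] [Finite F] :
    IsLevyFamily (fun n : ℕ => RankSL F (2 ^ (n + 1)))
      (fun _ => ProbabilityTheory.uniformOn Set.univ) where
  isProbabilityMeasure _ := inferInstance
  diam_eq_one m := Metric.diam_univ_eq_one dist_le_one (exists_dist_eq_one m)
  tendsto_zero _ hr := by
    let _ := fun m : ℕ => Fintype.ofFinite (RankSL F (2 ^ (m + 1)))
    exact tendsto_concentrationFunction (fun m => lipschitzVarianceLE (by positivity))
      tendsto_four_div_two_pow hr

/-! ### The completed inductive limit -/

theorem isHaarMeasure_uniformOn_univ (G : Type*) [Group G] [TopologicalSpace G] [T1Space G]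
    [Finite G] [MeasurableSpace G] [BorelSpace G] :
    (ProbabilityTheory.uniformOn (Set.univ : Set G)).IsHaarMeasure := by
  let _ := Fintype.ofFinite G
  have happly : ∀ s : Set G, ProbabilityTheory.uniformOn (Set.univ : Set G) s =
      s.encard / Fintype.card G := fun s => by
    rw [ProbabilityTheory.uniformOn_univ, Measure.count_apply s.toFinite.measurableSet]
  refine @Measure.IsHaarMeasure.mk _ _ _ _ _ inferInstance ⟨?_⟩ ⟨?_⟩
  · intro g
    ext s hs
    rw [Measure.map_apply (measurable_of_countable _) hs, happly, happly]
    congr 2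
    exact Set.encard_preimage_of_bijective (Group.mulLeft_bijective g) s
  · intro U _ hU
    rw [happly]
    simp [hU.ne_empty, ENNReal.div_eq_zero_iff]

namespace RankLimit

variable {F : Type u} [Field F]

theorem of_doubling (n : ℕ) (g : RankSL F (2 ^ n)) :
    of F (n + 1) (RankSL.doubling F n g) = of F n g := by
  have h : RankSL.transition F n (n + 1) n.le_succ g = RankSL.doubling F n g := by
    rw [RankSL.transition_succ n n le_rfl, RankSL.transition_self]
    rfl
  refine Quotient.sound ⟨n + 1, le_rfl, n.le_succ, ?_⟩
  change RankSL.transition F (n + 1) (n + 1) _ _ = RankSL.transition F n (n + 1) _ _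
  rw [h, RankSL.transition_self]
  rfl

end RankLimit

namespace RankCompletion

variable {F : Type u} [Field F]

variable (F) in
/-- The canonical homomorphism `SL_{2^n}(F) → A(F)`. -/
noncomputable def ofSL (n : ℕ) : RankSL F (2 ^ n) →* RankCompletion F where
  toFun g := coe (RankLimit.of F n g)
  map_one' := by rw [map_one, coe_one]
  map_mul' g h := by rw [map_mul, coe_mul]

theorem ofSL_apply (n : ℕ) (g : RankSL F (2 ^ n)) : ofSL F n g = coe (RankLimit.of F n g) := rfl

theorem isometry_ofSL (n : ℕ) : Isometry (ofSL F n) :=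
  Isometry.of_dist_eq fun g h => by rw [ofSL_apply, ofSL_apply, dist_coe, RankLimit.dist_of]

theorem monotone_range_ofSL : Monotone fun n => (ofSL F n).range :=
  monotone_nat_of_le_succ fun n => by
    rintro _ ⟨g, rfl⟩
    exact ⟨RankSL.doubling F n g, by rw [ofSL_apply, ofSL_apply, RankLimit.of_doubling]⟩

theorem dense_iUnion_range_ofSL :
    Dense (⋃ n, ((ofSL F (n + 1)).range : Set (RankCompletion F))) := by
  refine denseRange_coe.mono ?_
  rintro _ ⟨x, rfl⟩
  obtain ⟨n, g, -, rfl, -⟩ := RankLimit.exists_of₂ x x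
  exact Set.mem_iUnion.2 ⟨n, monotone_range_ofSL n.le_succ ⟨g, rfl⟩⟩

instance finite_range_ofSL [Finite F] (n : ℕ) : Finite (ofSL F n).range :=
  (Set.finite_range (ofSL F n)).to_subtype

theorem lipschitzVarianceLE_range_ofSL [Finite F] (n : ℕ) [Fintype (ofSL F n).range] :
    LipschitzVarianceLE (ofSL F n).range (4 / (2 ^ n : ℕ) : ℝ) := by
  let _ := Fintype.ofFinite (RankSL F (2 ^ n))
  refine (RankSL.lipschitzVarianceLE (by positivity)).of_isometryEquiv
    (IsometryEquiv.mk (Equiv.ofInjective _ (isometry_ofSL n).injective) ?_)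
  exact Isometry.of_dist_eq fun g h => (isometry_ofSL n).dist_eq g h

theorem diam_range_ofSL (n : ℕ) :
    Metric.diam (Set.univ : Set (ofSL F (n + 1)).range) = 1 := by
  refine Metric.diam_univ_eq_one ?_ ?_
  · rintro ⟨_, g, rfl⟩ ⟨_, h, rfl⟩
    exact ((isometry_ofSL (n + 1)).dist_eq g h).trans_le (RankSL.dist_le_one g h)
  · obtain ⟨g, h, hgh⟩ := RankSL.exists_dist_eq_one (F := F) n
    exact ⟨⟨_, g, rfl⟩, ⟨_, h, rfl⟩, ((isometry_ofSL (n + 1)).dist_eq g h).trans hgh⟩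

theorem isLevyGroup [Finite F] : IsLevyGroup (RankCompletion F) := by
  let _ := fun n => Fintype.ofFinite (ofSL F (n + 1)).range
  refine ⟨fun n => (ofSL F (n + 1)).range, fun _ => ProbabilityTheory.uniformOn Set.univ,
    fun m n h => monotone_range_ofSL (by omega), dense_iUnion_range_ofSL,
    fun n => (Set.toFinite _).isCompact, fun n => isHaarMeasure_uniformOn_univ _,
    fun n => inferInstance, fun n => inferInstance, diam_range_ofSL, fun r hr => ?_⟩
  exact tendsto_concentrationFunction (fun n => lipschitzVarianceLE_range_ofSL (n + 1))
    RankSL.tendsto_four_div_two_pow hr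

theorem isExtremelyAmenable [Finite F] : IsExtremelyAmenable.{u, v} (RankCompletion F) := by
  let _ := fun n => Fintype.ofFinite (ofSL F (n + 1)).range
  exact isExtremelyAmenable_of_lipschitzVarianceLE (fun n => (ofSL F (n + 1)).range)
    (fun m n h => monotone_range_ofSL (by omega)) dense_iUnion_range_ofSL
    RankSL.tendsto_four_div_two_pow fun n => lipschitzVarianceLE_range_ofSL (n + 1)

end RankCompletion

theorem mainTheorem2 (F : Type u) [Field F] [Finite F] :
    IsLevyFamily (fun n : ℕ => RankSL F (2 ^ (n + 1)))
      (fun _ => ProbabilityTheory.uniformOn Set.univ) ∧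
    IsLevyGroup (RankCompletion F) ∧
    IsExtremelyAmenable.{u, v} (RankCompletion F) :=
  ⟨RankSL.isLevyFamily F, RankCompletion.isLevyGroup, RankCompletion.isExtremelyAmenable⟩
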